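/- Let $\beta\in\mathbb{C}$ be one of the two non-real roots of $x^3-2x^2-1$ (so $|\beta|<1$), and let $$f_1(z)=\beta z,\qquad f_2(z)=\beta^3 z+\beta^3,\qquad f_3(z)=\beta z+\beta^2-\beta .$$ There is a unique nonempty compact set $\Omega_{AB}\subset\mathbb{C}$ with $\Omega_{AB}=f_1(\Omega_{AB})\cup f_2(\Omega_{AB})\cup f_3(\Omega_{AB})$, and it has the following properties. 1. $\Omega_{AB}$ is inversion symmetric in the center $-\tfrac12\beta$, i.e. it is mapped onto itself by $z\mapsto -z-\beta$. 2. $\Omega_{AB}$ has Hausdorff dimension $2$. 3. $\Omega_{AB}$ has positive two-dimensional Hausdorff measure and positive Lebesgue measure (area). 4. The boundary $\partial\Omega_{AB}$ has Lebesgue measure zero. 5. There is a periodic tiling of the plane with $\Omega_{AB}$ as prototile; more precisely, the translates $m+n(\beta^2-2\beta)+\Omega_{AB}$ with $m,n\in\mathbb{Z}$ form such a tiling. Here a tiling is a countable collection of compact sets with nonempty interior that covers $\mathbb{C}$ and whose distinct members have disjoint interiors, $\Omega_{AB}$ is its prototile if every member is congruent to $\Omega_{AB}$, and it is periodic if it is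 invariant under translation by two vectors that are linearly independent over $\mathbb{R}$. -/

import Mathlib

open Set MeasureTheory

/-- `K` is an attractor of the iterated function system `f`: a nonempty compact solution of
`K = ⋃ i, f i (K)`. -/
def IsAttractor {ι X : Type*} [TopologicalSpace X] (f : ι → X → X) (K : Set X) : Prop :=
  K.Nonempty ∧ IsCompact K ∧ K = ⋃ i, f i '' K

/-- The iterated function system `z ↦ β z`, `z ↦ β³ z + β³`, `z ↦ β z + β² - β` on `ℂ`. -/
def ifsAB (β : ℂ) : Fin 3 → ℂ → ℂ :=
  ![fun z => β * z, fun z => β ^ 3 * z + β ^ 3, fun z => β * z + β ^ 2 - β]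

/-- A tiling of the plane: a countable collection of compact sets with nonempty interior that
covers the plane and whose members have pairwise disjoint interiors. -/
structure IsTiling (T : Set (Set ℂ)) : Prop where
  countable : T.Countable
  isCompact : ∀ t ∈ T, IsCompact t
  interior_nonempty : ∀ t ∈ T, (interior t).Nonempty
  sUnion_eq : ⋃₀ T = univ
  disjoint_interior : T.Pairwise fun s t => Disjoint (interior s) (interior t)

/-- `P` is the (only) prototile of `T`: every tile of `T` is congruent to `P`. -/
def IsPrototile (P : Set ℂ) (T : Set (Set ℂ)) : Prop :=
  ∀ t ∈ T, ∃ g : ℂ ≃ᵢ ℂ, t = g '' P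

/-- `u` is a period of the collection `T`: translation by `u` maps `T` onto itself. -/
def IsPeriod (u : ℂ) (T : Set (Set ℂ)) : Prop :=
  (fun t : Set ℂ => (fun z => u + z) '' t) '' T = T

/-- `T` is periodic: it has two periods that are linearly independent over `ℝ`. -/
def IsPeriodic (T : Set (Set ℂ)) : Prop :=
  ∃ u v : ℂ, LinearIndependent ℝ ![u, v] ∧ IsPeriod u T ∧ IsPeriod v T

/-- The collection of all translates `m u + n v + P` of `P` with `m, n` integers. -/
def latticeTranslates (u v : ℂ) (P : Set ℂ) : Set (Set ℂ) :=
  {t | ∃ m n : ℤ, t = (fun z => (m * u + n * v) + z) '' P}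

/-! Put v = β² - 2β = 1/β and L = ℤ + ℤv. As β² = v + 2β, the ring ℤ[β] equals ℤβ + L; it contains
every βⁿL, hence is dense in ℂ.

Covering (`iUnion_tile_eq_univ`): from each point of the orbit of 0 under the three maps, some other
orbit point is reached by adding β modulo L (`OrbitAB.exists_succ`). Together with the point
symmetry, this makes Ω meet every class kβ + L. The union of the translates is closed and contains
ℤ[β], so it is the whole plane.

No overlap (`volume_overlap`): since 2|β|² + |β|⁶ = 1, the indicator of Ω is a.e. the sum of those
of its three pieces. This yields the identity `indicator_attractor_sub_ae_eq`; summed over L, it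
shows that the number of translates through z is a.e. invariant under z ↦ z - β, hence under ℤ[β].
Explicit estimates place -β/2 in no translate other than Ω itself, so this number is at most 1 on an
open set, and by density it is at most 1 a.e.

The boundary lies in the null set of overlaps, and Ω contains a neighbourhood of -β/2, which gives
the dimension and the positive measures. -/

open scoped NNReal

/-! ### Existence and uniqueness of attractors -/

/-- A finite nonempty family of contractions of a complete metric space has exactly one
attractor. -/
theorem existsUnique_isAttractor {ι X : Type*} [Finite ι] [Nonempty ι] [MetricSpace X]
    [CompleteSpace X] [Nonempty X] {K : ℝ≥0} (hK : K < 1) {f : ι → X → X}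
    (hf : ∀ i, LipschitzWith K (f i)) : ∃! S : Set X, IsAttractor f S := by
  -- Banach's theorem is applied to the union-of-images operator on nonempty compact sets with the
  -- Hausdorff distance.
  let F : TopologicalSpace.NonemptyCompacts X → TopologicalSpace.NonemptyCompacts X := fun S =>
    { carrier := ⋃ i, f i '' S
      isCompact' := isCompact_iUnion fun i => S.isCompact.image (hf i).continuous
      nonempty' := by
        obtain ⟨i⟩ := ‹Nonempty ι›
        exact (S.nonempty.image (f i)).mono (subset_iUnion (fun i => f i '' (S : Set X)) i) }
  have key : ∀ S T : TopologicalSpace.NonemptyCompacts X, ∀ x ∈ F S, ∃ y ∈ F T,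
      edist x y ≤ K * Metric.hausdorffEDist (S : Set X) T := by
    intro S T x hx
    obtain ⟨i, z, hz, rfl⟩ := mem_iUnion.1 hx
    obtain ⟨w, hw, hzw⟩ := T.isCompact.exists_infEDist_eq_edist T.nonempty z
    refine ⟨f i w, mem_iUnion.2 ⟨i, w, hw, rfl⟩, (hf i z w).trans ?_⟩
    rw [← hzw]
    gcongr
    exact Metric.infEDist_le_hausdorffEDist_of_mem hz
  have hF : ContractingWith K F := by
    refine ⟨hK, fun S T => Metric.hausdorffEDist_le_of_mem_edist (key S T) ?_⟩
    change ∀ x ∈ F T, ∃ y ∈ F S, edist x y ≤ K * Metric.hausdorffEDist (S : Set X) T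
    rw [Metric.hausdorffEDist_comm]
    exact key T S
  have : Nonempty (TopologicalSpace.NonemptyCompacts X) :=
    ⟨{Classical.arbitrary X}⟩
  refine ⟨(ContractingWith.fixedPoint F hF : TopologicalSpace.NonemptyCompacts X), ⟨TopologicalSpace.NonemptyCompacts.nonempty _,
    TopologicalSpace.NonemptyCompacts.isCompact _, ?_⟩, ?_⟩
  · exact (congrArg SetLike.coe hF.fixedPoint_isFixedPt).symm
  · rintro S ⟨hne, hc, hS⟩
    have h := hF.fixedPoint_unique (x := ⟨⟨S, hc⟩, hne⟩)
      (TopologicalSpace.NonemptyCompacts.ext hS.symm)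
    exact congrArg SetLike.coe h

/-! ### Arithmetic of `β` -/

theorem inv_mul_root {β : ℂ} (hβ : β ^ 3 - 2 * β ^ 2 - 1 = 0) : (β ^ 2 - 2 * β) * β = 1 := by
  linear_combination hβ

theorem im_sq_root {β : ℂ} (hβ : β ^ 3 - 2 * β ^ 2 - 1 = 0) (hβ_im : β.im ≠ 0) :
    β.im ^ 2 = 3 * β.re ^ 2 - 4 * β.re := by
  have h := congrArg Complex.im hβ
  simp [pow_succ] at h
  apply mul_left_cancel₀ hβ_im
  linear_combination -h

/-- By Vieta the real root is 2 - 2 Re β, and its product with |β|² is 1. All numerical bounds on β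
come from this cubic. -/
theorem re_root_cubic {β : ℂ} (hβ : β ^ 3 - 2 * β ^ 2 - 1 = 0) (hβ_im : β.im ≠ 0) :
    8 * β.re * (1 - β.re) ^ 2 = -1 := by
  have h := congrArg Complex.re hβ
  simp [pow_succ] at h
  linear_combination -h - (3 * β.re - 2) * im_sq_root hβ hβ_im

theorem re_root_bounds {β : ℂ} (hβ : β ^ 3 - 2 * β ^ 2 - 1 = 0) (hβ_im : β.im ≠ 0) :
    -0.1029 < β.re ∧ β.re < -0.1027 := by
  have h := re_root_cubic hβ hβ_im
  generalize β.re = a at h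
  have ha : a < 0 := by
    by_contra! ha
    nlinarith [mul_nonneg ha (sq_nonneg (1 - a))]
  constructor <;> by_contra! h'
  · nlinarith [sq_nonneg (1 - a), sq_nonneg a]
  · have h1 : (1 - a) ^ 2 ≤ 1.1027 ^ 2 := by nlinarith
    nlinarith

theorem norm_sq_root {β : ℂ} (hβ : β ^ 3 - 2 * β ^ 2 - 1 = 0) (hβ_im : β.im ≠ 0) :
    ‖β‖ ^ 2 = 4 * β.re ^ 2 - 4 * β.re := by
  rw [← Complex.normSq_eq_norm_sq, Complex.normSq_apply]
  linear_combination im_sq_root hβ hβ_im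

theorem norm_root_bounds {β : ℂ} (hβ : β ^ 3 - 2 * β ^ 2 - 1 = 0) (hβ_im : β.im ≠ 0) :
    0.45 < ‖β‖ ^ 2 ∧ ‖β‖ < 0.6738 := by
  have h := re_root_bounds hβ hβ_im
  have h2 := norm_sq_root hβ hβ_im
  constructor
  · nlinarith
  · apply lt_of_pow_lt_pow_left₀ 2 (by norm_num)
    nlinarith

/-- With r the real root, |β|² = 1/r, and 2/r + 1/r³ = 1 is the equation of r. The areas of the
three pieces thus add up to that of Ω. -/
theorem norm_root_area {β : ℂ} (hβ : β ^ 3 - 2 * β ^ 2 - 1 = 0) (hβ_im : β.im ≠ 0) :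
    ‖β‖ ^ 2 + ‖β ^ 3‖ ^ 2 + ‖β‖ ^ 2 = 1 := by
  have h3 : ‖β ^ 3‖ ^ 2 = (‖β‖ ^ 2) ^ 3 := by rw [norm_pow]; ring
  rw [h3, norm_sq_root hβ hβ_im]
  have h := re_root_cubic hβ hβ_im
  generalize β.re = a at h
  linear_combination (8 * a ^ 3 - 8 * a ^ 2 - 1) * h

theorem root_ne_zero {β : ℂ} (hβ_im : β.im ≠ 0) : β ≠ 0 := by
  rintro rfl
  simp at hβ_im

theorem norm_root_lt_one {β : ℂ} (hβ : β ^ 3 - 2 * β ^ 2 - 1 = 0) (hβ_im : β.im ≠ 0) :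
    ‖β‖ < 1 := (norm_root_bounds hβ hβ_im).2.trans (by norm_num)

theorem inv_root_im {β : ℂ} : (β ^ 2 - 2 * β).im = 2 * β.im * (β.re - 1) := by
  simp [pow_succ]
  ring

theorem inv_root_im_sq {β : ℂ} (hβ : β ^ 3 - 2 * β ^ 2 - 1 = 0) (hβ_im : β.im ≠ 0) :
    2 < (β ^ 2 - 2 * β).im ^ 2 := by
  have h := re_root_bounds hβ hβ_im
  have h1 : (1.1027 : ℝ) ^ 2 ≤ (β.re - 1) ^ 2 := by nlinarith
  have h2 : 0.4424 ≤ β.im ^ 2 := by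
    rw [im_sq_root hβ hβ_im]
    nlinarith
  calc (2 : ℝ) < 4 * 0.4424 * 1.1027 ^ 2 := by norm_num
    _ ≤ 4 * β.im ^ 2 * (β.re - 1) ^ 2 := by gcongr
    _ = _ := by rw [inv_root_im]; ring

theorem inv_root_im_ne_zero {β : ℂ} (hβ : β ^ 3 - 2 * β ^ 2 - 1 = 0) (hβ_im : β.im ≠ 0) :
    (β ^ 2 - 2 * β).im ≠ 0 := by
  intro h
  have := inv_root_im_sq hβ hβ_im
  rw [h] at this
  norm_num at this

/-! ### The attractor of `ifsAB` -/

theorem mem_isAttractor_ifsAB {β : ℂ} {Ω : Set ℂ} (h : IsAttractor (ifsAB β) Ω) {z : ℂ} :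
    z ∈ Ω ↔ (∃ w ∈ Ω, β * w = z) ∨ (∃ w ∈ Ω, β ^ 3 * w + β ^ 3 = z) ∨
      ∃ w ∈ Ω, β * w + β ^ 2 - β = z := by
  conv_lhs => rw [h.2.2]
  simp [ifsAB, Fin.exists_fin_succ]

theorem existsUnique_isAttractor_ifsAB {β : ℂ} (hβ : ‖β‖ < 1) :
    ∃! Ω : Set ℂ, IsAttractor (ifsAB β) Ω := by
  refine existsUnique_isAttractor (K := ‖β‖₊) (by exact_mod_cast hβ) fun i => ?_
  refine LipschitzWith.of_dist_le_mul fun x y => ?_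
  rw [coe_nnnorm, dist_eq_norm, dist_eq_norm]
  fin_cases i
  · simp [ifsAB, ← mul_sub]
  · simp only [ifsAB, Fin.mk_one, Matrix.cons_val_one, Matrix.cons_val_zero,
      add_sub_add_right_eq_sub, ← mul_sub, norm_mul, norm_pow]
    gcongr
    exact pow_le_of_le_one (norm_nonneg _) hβ.le (by norm_num)
  · refine le_of_eq ?_
    rw [← norm_mul]
    congr 1
    simp [ifsAB]
    ring

/-- Conjugation by z ↦ -z - β swaps f₁ and f₃ and fixes f₂, so the image of Ω is again an attractor;
uniqueness concludes. -/
theorem neg_sub_mem_isAttractor_ifsAB {β : ℂ} (hβ : β ^ 3 - 2 * β ^ 2 - 1 = 0) (h1 : ‖β‖ < 1)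
    {Ω : Set ℂ} (h : IsAttractor (ifsAB β) Ω) {z : ℂ} (hz : z ∈ Ω) : -z - β ∈ Ω := by
  have key : IsAttractor (ifsAB β) ((fun z => -z - β) '' Ω) := by
    refine ⟨h.1.image _, h.2.1.image (by fun_prop), ?_⟩
    have hσ : ∀ z, z ∈ (fun z => -z - β) '' Ω ↔ -z - β ∈ Ω := fun z =>
      ⟨by rintro ⟨w, hw, rfl⟩; simpa using hw, fun hz => ⟨_, hz, by ring⟩⟩
    ext z
    have hU : z ∈ ⋃ i, ifsAB β i '' ((fun z => -z - β) '' Ω) ↔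
        (∃ w ∈ Ω, β * (-w - β) = z) ∨ (∃ w ∈ Ω, β ^ 3 * (-w - β) + β ^ 3 = z) ∨
          ∃ w ∈ Ω, β * (-w - β) + β ^ 2 - β = z := by
      simp [ifsAB, Fin.exists_fin_succ]
    rw [hU, hσ, mem_isAttractor_ifsAB h]
    constructor
    · rintro (⟨w, hw, e⟩ | ⟨w, hw, e⟩ | ⟨w, hw, e⟩)
      · exact Or.inr (Or.inr ⟨w, hw, by linear_combination -e⟩)
      · exact Or.inr (Or.inl ⟨w, hw, by linear_combination -e - β * hβ⟩)
      · exact Or.inl ⟨w, hw, by linear_combination -e⟩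
    · rintro (⟨w, hw, e⟩ | ⟨w, hw, e⟩ | ⟨w, hw, e⟩)
      · exact Or.inr (Or.inr ⟨w, hw, by linear_combination -e⟩)
      · exact Or.inr (Or.inl ⟨w, hw, by linear_combination -e - β * hβ⟩)
      · exact Or.inl ⟨w, hw, by linear_combination -e⟩
  rw [(existsUnique_isAttractor_ifsAB h1).unique h key]
  exact mem_image_of_mem _ hz

/-! ### Lattice translates -/

/-- The point `m + n v` of the lattice generated by `1` and `v`. -/
def latticePoint (v : ℂ) (p : ℤ × ℤ) : ℂ := p.1 * 1 + p.2 * v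

/-- The translate of `Ω` by the lattice point `m + n v`. -/
def tile (v : ℂ) (Ω : Set ℂ) (p : ℤ × ℤ) : Set ℂ := (fun z => latticePoint v p + z) '' Ω

theorem mem_tile {v : ℂ} {Ω : Set ℂ} {p : ℤ × ℤ} {z : ℂ} :
    z ∈ tile v Ω p ↔ z - latticePoint v p ∈ Ω :=
  ⟨by rintro ⟨w, hw, rfl⟩; simpa using hw, fun h => ⟨_, h, by ring⟩⟩

theorem tile_zero (v : ℂ) (Ω : Set ℂ) : tile v Ω 0 = Ω := by
  ext z
  simp [mem_tile, latticePoint]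

theorem latticePoint_add (v : ℂ) (p q : ℤ × ℤ) :
    latticePoint v (p + q) = latticePoint v p + latticePoint v q := by
  simp [latticePoint]
  ring

theorem latticePoint_neg (v : ℂ) (p : ℤ × ℤ) : latticePoint v (-p) = -latticePoint v p := by
  simp [latticePoint]
  ring

theorem latticePoint_im (v : ℂ) (p : ℤ × ℤ) : (latticePoint v p).im = p.2 * v.im := by
  simp [latticePoint]

theorem finite_latticePoint_mem {v : ℂ} (hv : v.im ≠ 0) {B : Set ℂ} (hB : Bornology.IsBounded B) :
    {p | latticePoint v p ∈ B}.Finite := by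
  obtain ⟨R, hR⟩ := hB.exists_norm_le
  set N : ℝ := R / |v.im|
  set N' : ℝ := R + N * ‖v‖
  refine ((finite_Icc ⌈-N'⌉ ⌊N'⌋).prod (finite_Icc ⌈-N⌉ ⌊N⌋)).subset ?_
  intro p hp
  have h := hR _ hp
  have h2 : |(p.2 : ℝ)| ≤ N := by
    rw [le_div_iff₀ (abs_pos.2 hv), ← abs_mul, ← latticePoint_im]
    exact (Complex.abs_im_le_norm _).trans h
  have h1 : |(p.1 : ℝ)| ≤ N' := by
    have e : (p.1 : ℂ) = latticePoint v p - p.2 * v := by simp [latticePoint]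
    calc |(p.1 : ℝ)| = ‖(p.1 : ℂ)‖ := by simp
      _ ≤ ‖latticePoint v p‖ + ‖(p.2 : ℂ) * v‖ := by rw [e]; exact norm_sub_le _ _
      _ ≤ N' := by
        rw [norm_mul, Complex.norm_intCast]
        exact add_le_add h (mul_le_mul_of_nonneg_right h2 (norm_nonneg _))
  rw [abs_le] at h1 h2
  exact ⟨⟨Int.ceil_le.2 h1.1, Int.le_floor.2 h1.2⟩, ⟨Int.ceil_le.2 h2.1, Int.le_floor.2 h2.2⟩⟩

theorem locallyFinite_tile {v : ℂ} (hv : v.im ≠ 0) {Ω : Set ℂ} (hΩ : Bornology.IsBounded Ω) :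
    LocallyFinite (tile v Ω) := by
  intro z
  refine ⟨Metric.ball z 1, Metric.ball_mem_nhds z one_pos,
    (finite_latticePoint_mem hv ((Metric.isBounded_ball (x := z) (r := 1)).sub hΩ)).subset ?_⟩
  rintro p ⟨_, ⟨w, hw, rfl⟩, hp⟩
  exact ⟨_, hp, w, hw, by simp⟩

theorem isCompact_tile {v : ℂ} {Ω : Set ℂ} (hΩ : IsCompact Ω) (p : ℤ × ℤ) :
    IsCompact (tile v Ω p) := hΩ.image (by fun_prop)

theorem isClosed_iUnion_tile {v : ℂ} (hv : v.im ≠ 0) {Ω : Set ℂ} (hΩ : IsCompact Ω) :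
    IsClosed (⋃ p, tile v Ω p) :=
  (locallyFinite_tile hv hΩ.isBounded).isClosed_iUnion fun p => (isCompact_tile hΩ p).isClosed

theorem exists_norm_sub_latticePoint_le {v : ℂ} (hv : v.im ≠ 0) (w : ℂ) :
    ∃ p, ‖w - latticePoint v p‖ ≤ 1 + ‖v‖ := by
  set y := w.im / v.im
  set x := w.re - y * v.re
  have hw : w = x + y * v := by
    apply Complex.ext
    · simp [x]
    · simp [y, hv]
  have hr : ∀ t : ℝ, ‖((t - round t : ℝ) : ℂ)‖ ≤ 1 := fun t => by
    rw [Complex.norm_real]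
    exact (abs_sub_round t).trans (by norm_num)
  refine ⟨(round x, round y), ?_⟩
  have e : w - latticePoint v (round x, round y) =
      ((x - round x : ℝ) : ℂ) + ((y - round y : ℝ) : ℂ) * v := by
    conv_lhs => rw [hw]
    simp [latticePoint]
    ring
  rw [e]
  refine (norm_add_le _ _).trans (add_le_add (hr x) ?_)
  rw [norm_mul]
  exact mul_le_of_le_one_left (norm_nonneg _) (hr y)

/-! ### Density of `ℤ[β]` -/

theorem exists_pow_mul_latticePoint {β : ℂ} (hβ : β ^ 3 - 2 * β ^ 2 - 1 = 0) (n : ℕ) (p : ℤ × ℤ) :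
    ∃ (k : ℤ) (q : ℤ × ℤ),
      β ^ n * latticePoint (β ^ 2 - 2 * β) p = k * β + latticePoint (β ^ 2 - 2 * β) q := by
  induction n with
  | zero => exact ⟨0, p, by simp⟩
  | succ n ih =>
    obtain ⟨k, q, h⟩ := ih
    -- With v = β² - 2β: β·β = v + 2β and β·v = 1.
    refine ⟨2 * k + q.1, (q.2, k), ?_⟩
    rw [pow_succ', mul_assoc, h]
    simp [latticePoint]
    linear_combination q.2 * hβ

theorem exists_norm_sub_root_ring_lt {β : ℂ} (hβ : β ^ 3 - 2 * β ^ 2 - 1 = 0) (hβ_im : β.im ≠ 0)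
    (z : ℂ) {ε : ℝ} (hε : 0 < ε) :
    ∃ (k : ℤ) (q : ℤ × ℤ), ‖z - (k * β + latticePoint (β ^ 2 - 2 * β) q)‖ < ε := by
  have hv := inv_root_im_ne_zero hβ hβ_im
  have hC : 0 < 1 + ‖β ^ 2 - 2 * β‖ := by positivity
  obtain ⟨n, hn⟩ := exists_pow_lt_of_lt_one (div_pos hε hC) (norm_root_lt_one hβ hβ_im)
  obtain ⟨p, hp⟩ := exists_norm_sub_latticePoint_le hv (z / β ^ n)
  obtain ⟨k, q, h⟩ := exists_pow_mul_latticePoint hβ n p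
  refine ⟨k, q, ?_⟩
  have h0 : β ^ n ≠ 0 := pow_ne_zero _ (root_ne_zero hβ_im)
  have e : z - (k * β + latticePoint (β ^ 2 - 2 * β) q) =
      β ^ n * (z / β ^ n - latticePoint (β ^ 2 - 2 * β) p) := by
    rw [← h, mul_sub, mul_div_cancel₀ _ h0]
  rw [e, norm_mul, norm_pow]
  calc ‖β‖ ^ n * _ ≤ ‖β‖ ^ n * (1 + ‖β ^ 2 - 2 * β‖) := by gcongr
    _ < ε := (lt_div_iff₀ hC).1 hn

/-! ### The translates of the attractor cover the plane -/

/-- The points obtained from `0` by applying the maps of `ifsAB β` finitely often. -/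
inductive OrbitAB (β : ℂ) : ℂ → Prop
  | zero : OrbitAB β 0
  | fst {w : ℂ} : OrbitAB β w → OrbitAB β (β * w)
  | snd {w : ℂ} : OrbitAB β w → OrbitAB β (β ^ 3 * w + β ^ 3)
  | trd {w : ℂ} : OrbitAB β w → OrbitAB β (β * w + β ^ 2 - β)

theorem OrbitAB.mem {β : ℂ} (h1 : ‖β‖ < 1) {Ω : Set ℂ} (h : IsAttractor (ifsAB β) Ω) {x : ℂ}
    (hx : OrbitAB β x) : x ∈ Ω := by
  induction hx with
  | zero =>
    obtain ⟨w, hw⟩ := h.1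
    have hn : ∀ n : ℕ, β ^ n * w ∈ Ω := fun n => by
      induction n with
      | zero => simpa using hw
      | succ n ih => exact (mem_isAttractor_ifsAB h).2 (Or.inl ⟨_, ih, by ring⟩)
    have hlim : Filter.Tendsto (fun n : ℕ => β ^ n * w) Filter.atTop (nhds 0) := by
      simpa using (tendsto_pow_atTop_nhds_zero_of_norm_lt_one h1).mul_const w
    exact h.2.1.isClosed.mem_of_tendsto hlim (Filter.Eventually.of_forall hn)
  | fst _ ih => exact (mem_isAttractor_ifsAB h).2 (Or.inl ⟨_, ih, rfl⟩)
  | snd _ ih => exact (mem_isAttractor_ifsAB h).2 (Or.inr (Or.inl ⟨_, ih, rfl⟩))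
  | trd _ ih => exact (mem_isAttractor_ifsAB h).2 (Or.inr (Or.inr ⟨_, ih, rfl⟩))

/-- The increments β² - β = v + β, β and 1 + β are all congruent to β modulo L. The form of x
recorded in the first and third cases is what lets the induction pass through the third map. -/
theorem OrbitAB.exists_succ {β : ℂ} (hβ : β ^ 3 - 2 * β ^ 2 - 1 = 0) {x : ℂ} (hx : OrbitAB β x) :
    ((∃ w, OrbitAB β w ∧ x = β * w) ∧ OrbitAB β (x + (β ^ 2 - β))) ∨ OrbitAB β (x + β) ∨
      ((∃ w, OrbitAB β w ∧ x = β * (β * w) + β ^ 2 - β) ∧ OrbitAB β (x + (1 + β))) := by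
  induction hx with
  | zero => exact Or.inl ⟨⟨0, .zero, by simp⟩, by convert! OrbitAB.zero.trd using 1; ring⟩
  | @fst w hw _ => exact Or.inl ⟨⟨w, hw, rfl⟩, by convert! hw.trd using 1; ring⟩
  | @snd w hw _ =>
    refine Or.inr (Or.inl ?_)
    convert! hw.trd.fst.fst using 1
    linear_combination -β * hβ
  | @trd w _ ih =>
    rcases ih with ⟨⟨u, hu, rfl⟩, h⟩ | h | ⟨⟨u, hu, rfl⟩, h⟩
    · refine Or.inr (Or.inr ⟨⟨u, hu, rfl⟩, ?_⟩)
      convert! h.fst using 1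
      linear_combination -hβ
    · refine Or.inr (Or.inl ?_)
      convert! h.fst using 1
      ring
    · refine Or.inr (Or.inl ?_)
      convert! hu.snd using 1
      ring

theorem exists_orbitAB_eq {β : ℂ} (hβ : β ^ 3 - 2 * β ^ 2 - 1 = 0) (n : ℕ) :
    ∃ q, OrbitAB β (n * β + latticePoint (β ^ 2 - 2 * β) q) := by
  induction n with
  | zero => exact ⟨0, by simpa [latticePoint] using OrbitAB.zero⟩
  | succ n ih =>
    obtain ⟨q, hq⟩ := ih
    rcases hq.exists_succ hβ with ⟨-, h⟩ | h | ⟨-, h⟩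
    · exact ⟨q + (0, 1), by convert! h using 1; simp [latticePoint]; ring⟩
    · exact ⟨q, by convert! h using 1; simp [latticePoint]; ring⟩
    · exact ⟨q + (1, 0), by convert! h using 1; simp [latticePoint]; ring⟩

theorem exists_int_mul_root_add_mem {β : ℂ} (hβ : β ^ 3 - 2 * β ^ 2 - 1 = 0) (h1 : ‖β‖ < 1)
    {Ω : Set ℂ} (h : IsAttractor (ifsAB β) Ω) (k : ℤ) :
    ∃ q, k * β + latticePoint (β ^ 2 - 2 * β) q ∈ Ω := by
  rcases k with n | n
  · obtain ⟨q, hq⟩ := exists_orbitAB_eq hβ n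
    exact ⟨q, by simpa using hq.mem h1 h⟩
  -- Here k = -(n + 1); the symmetry z ↦ -z - β supplies the extra -β.
  · obtain ⟨q, hq⟩ := exists_orbitAB_eq hβ n
    refine ⟨-q, ?_⟩
    have := neg_sub_mem_isAttractor_ifsAB hβ h1 h (hq.mem h1 h)
    convert! this using 1
    rw [latticePoint_neg]
    push_cast
    ring

theorem iUnion_tile_eq_univ {β : ℂ} (hβ : β ^ 3 - 2 * β ^ 2 - 1 = 0) (hβ_im : β.im ≠ 0)
    {Ω : Set ℂ} (h : IsAttractor (ifsAB β) Ω) : ⋃ p, tile (β ^ 2 - 2 * β) Ω p = univ := by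
  have hcl := isClosed_iUnion_tile (inv_root_im_ne_zero hβ hβ_im) h.2.1
  rw [← hcl.closure_eq, eq_univ_iff_forall]
  intro z
  rw [Metric.mem_closure_iff]
  intro ε hε
  obtain ⟨k, q, hkq⟩ := exists_norm_sub_root_ring_lt hβ hβ_im z hε
  obtain ⟨r, hr⟩ := exists_int_mul_root_add_mem hβ (norm_root_lt_one hβ hβ_im) h k
  refine ⟨_, mem_iUnion.2 ⟨q - r, mem_tile.2 ?_⟩, by rwa [dist_eq_norm]⟩
  convert! hr using 1
  rw [sub_eq_add_neg q r, latticePoint_add, latticePoint_neg]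
  ring

/-! ### The center of symmetry lies in one translate only -/

theorem norm_one_sub_root_lt {β : ℂ} (hβ : β ^ 3 - 2 * β ^ 2 - 1 = 0) (hβ_im : β.im ≠ 0) :
    ‖1 - β‖ < 1.2884 := by
  have h := re_root_bounds hβ hβ_im
  apply lt_of_pow_lt_pow_left₀ 2 (by norm_num)
  rw [← Complex.normSq_eq_norm_sq, Complex.normSq_apply]
  simp only [Complex.sub_re, Complex.one_re, Complex.sub_im, Complex.one_im]
  nlinarith [im_sq_root hβ hβ_im]

/-- Seen from -β/2, f₂ is multiplication by β³, while f₁ and f₃ are multiplication by β followed by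
a shift of ±β(1 - β)/2. The maximal distance R therefore satisfies R ≤ 0.6738 R + 0.6738 · 1.2884 /
2 or R ≤ 0.6738 R. -/
theorem norm_add_half_root_le {β : ℂ} (hβ : β ^ 3 - 2 * β ^ 2 - 1 = 0) (hβ_im : β.im ≠ 0)
    {Ω : Set ℂ} (h : IsAttractor (ifsAB β) Ω) {z : ℂ} (hz : z ∈ Ω) :
    ‖z + β / 2‖ ≤ 1.331 := by
  obtain ⟨x, hx, hmax⟩ := h.2.1.exists_isMaxOn h.1
    (f := fun z => ‖z + β / 2‖) (by fun_prop)
  refine (hmax hz).trans ?_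
  have hρ := (norm_root_bounds hβ hβ_im).2
  have hd : ‖β * (1 - β) / 2‖ ≤ 0.6738 * 1.2884 / 2 := by
    rw [norm_div, norm_mul, Complex.norm_two]
    gcongr
    exact (norm_one_sub_root_lt hβ hβ_im).le
  have h0 := norm_nonneg (x + β / 2)
  have step : ∀ w ∈ Ω, ‖β * (w + β / 2)‖ ≤ 0.6738 * ‖x + β / 2‖ := fun w hw => by
    rw [norm_mul]
    exact mul_le_mul hρ.le (hmax hw) (norm_nonneg _) (by norm_num)
  change ‖x + β / 2‖ ≤ 1.331
  rcases (mem_isAttractor_ifsAB h).1 hx with ⟨w, hw, e⟩ | ⟨w, hw, e⟩ | ⟨w, hw, e⟩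
  · have e' : x + β / 2 = β * (w + β / 2) + β * (1 - β) / 2 := by rw [← e]; ring
    have := norm_add_le (β * (w + β / 2)) (β * (1 - β) / 2)
    rw [← e'] at this
    linarith [step w hw]
  · have e' : x + β / 2 = β ^ 2 * (β * (w + β / 2)) := by
      rw [← e]; linear_combination -β / 2 * hβ
    have h2 : ‖x + β / 2‖ ≤ 1 * ‖β * (w + β / 2)‖ := by
      rw [e', norm_mul]
      gcongr
      rw [norm_pow]
      exact pow_le_one₀ (norm_nonneg _) (by linarith)
    linarith [step w hw]
  · have e' : x + β / 2 = β * (w + β / 2) - β * (1 - β) / 2 := by rw [← e]; ring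
    have := norm_sub_le (β * (w + β / 2)) (β * (1 - β) / 2)
    rw [← e'] at this
    linarith [step w hw]

theorem one_sub_half_root_notMem {β : ℂ} (hβ : β ^ 3 - 2 * β ^ 2 - 1 = 0) (hβ_im : β.im ≠ 0)
    {Ω : Set ℂ} (h : IsAttractor (ifsAB β) Ω) : 1 - β / 2 ∉ Ω := by
  intro hmem
  have ha := re_root_bounds hβ hβ_im
  have hb := im_sq_root hβ hβ_im
  have hρ := (norm_root_bounds hβ hβ_im).2
  have step : ∀ w ∈ Ω, ‖β * (w + β / 2)‖ ^ 2 ≤ 0.8044 := fun w hw => by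
    have : ‖β * (w + β / 2)‖ ≤ 0.6738 * 1.331 := by
      rw [norm_mul]
      exact mul_le_mul hρ.le (norm_add_half_root_le hβ hβ_im h hw) (norm_nonneg _) (by norm_num)
    calc _ ≤ (0.6738 * 1.331 : ℝ) ^ 2 := by gcongr
      _ ≤ _ := by norm_num
  have hre : ((β - β ^ 2) / 2).re = (2 * β.re ^ 2 - 3 * β.re) / 2 := by
    simp [pow_two]
    linear_combination hb
  have him : ((β - β ^ 2) / 2).im = β.im * (1 - 2 * β.re) / 2 := by
    simp [pow_two]
    ring
  have him' : 0.16 ≤ (β.im * (1 - 2 * β.re) / 2) ^ 2 := by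
    have h1 : 0.4424 ≤ β.im ^ 2 := by nlinarith
    have h2 : (1.2054 : ℝ) ^ 2 ≤ (1 - 2 * β.re) ^ 2 := by
      gcongr
      linarith
    calc (0.16 : ℝ) ≤ 0.4424 * 1.2054 ^ 2 / 4 := by norm_num
      _ ≤ β.im ^ 2 * (1 - 2 * β.re) ^ 2 / 4 := by gcongr
      _ = _ := by ring
  -- Each possible preimage w is too far from -β/2: for f₁, say, 0.83² + 0.16 > 0.8044.
  rcases (mem_isAttractor_ifsAB h).1 hmem with ⟨w, hw, e⟩ | ⟨w, hw, e⟩ | ⟨w, hw, e⟩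
  · have e' : β * (w + β / 2) = 1 - (β - β ^ 2) / 2 := by linear_combination e
    have := step w hw
    rw [e', ← Complex.normSq_eq_norm_sq, Complex.normSq_apply] at this
    rw [Complex.sub_re, Complex.sub_im, hre, him, Complex.one_re, Complex.one_im] at this
    have h1 : 0.83 ≤ 1 - (2 * β.re ^ 2 - 3 * β.re) / 2 := by nlinarith
    nlinarith
  · have e' : β ^ 2 * (β * (w + β / 2)) = 1 := by linear_combination e + β / 2 * hβ
    have h2 := step w hw
    have h3 : ‖β‖ ^ 4 * ‖β * (w + β / 2)‖ ^ 2 = 1 := by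
      have := congrArg (fun z => ‖z‖ ^ 2) e'
      simp only [norm_mul, norm_pow, norm_one] at this
      rw [norm_mul]
      linear_combination this
    have h4 : ‖β‖ ^ 4 ≤ 1 := pow_le_one₀ (norm_nonneg _) (by linarith)
    nlinarith [sq_nonneg ‖β * (w + β / 2)‖]
  · have e' : β * (w + β / 2) = 1 + (β - β ^ 2) / 2 := by linear_combination e
    have := step w hw
    rw [e', ← Complex.normSq_eq_norm_sq, Complex.normSq_apply] at this
    rw [Complex.add_re, Complex.add_im, hre, him, Complex.one_re, Complex.one_im] at this
    have h1 : 1 ≤ 1 + (2 * β.re ^ 2 - 3 * β.re) / 2 := by nlinarith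
    nlinarith

/-- The radius bound leaves only lattice points of norm at most 1.331. As (Im v)² > 2 > 1.331²,
these are 0 and ±1, and ±1 reduce by symmetry to `one_sub_half_root_notMem`. -/
theorem neg_half_root_notMem_tile {β : ℂ} (hβ : β ^ 3 - 2 * β ^ 2 - 1 = 0) (hβ_im : β.im ≠ 0)
    {Ω : Set ℂ} (h : IsAttractor (ifsAB β) Ω) {p : ℤ × ℤ} (hp : p ≠ 0) :
    -(β / 2) ∉ tile (β ^ 2 - 2 * β) Ω p := by
  rw [mem_tile]
  intro hmem
  have hn := norm_add_half_root_le hβ hβ_im h hmem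
  have hn' : ‖latticePoint (β ^ 2 - 2 * β) p‖ ≤ 1.331 := by
    rw [← norm_neg]
    convert! hn using 2
    ring
  have hp2 : p.2 = 0 := by
    by_contra h2
    have h3 : (1 : ℝ) ≤ (p.2 : ℝ) ^ 2 := by
      exact_mod_cast (sq_pos_of_ne_zero h2 : 0 < p.2 ^ 2)
    have h4 := (Complex.abs_im_le_norm _).trans hn'
    rw [latticePoint_im] at h4
    have h5 : (p.2 * (β ^ 2 - 2 * β).im) ^ 2 ≤ (1.331 : ℝ) ^ 2 := by
      rw [← sq_abs]; gcongr
    nlinarith [inv_root_im_sq hβ hβ_im]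
  have hp1 : p.1 = 1 ∨ p.1 = -1 := by
    have h1 : p.1 ≠ 0 := fun h1 => hp (Prod.ext h1 hp2)
    have h3 : |(p.1 : ℝ)| ≤ 1.331 := by
      simpa [latticePoint, hp2] using hn'
    have h4 : |p.1| < 2 := by
      have : (|p.1| : ℝ) < 2 := by linarith
      exact_mod_cast this
    have := abs_lt.1 h4
    lia
  have hl : latticePoint (β ^ 2 - 2 * β) p = p.1 := by simp [latticePoint, hp2]
  rw [hl] at hmem
  apply one_sub_half_root_notMem hβ hβ_im h
  rcases hp1 with hp1 | hp1 <;> rw [hp1] at hmem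
  · convert! neg_sub_mem_isAttractor_ifsAB hβ (norm_root_lt_one hβ hβ_im) h hmem using 1
    push_cast
    ring
  · convert! hmem using 1
    push_cast
    ring

/-! ### Similarities and Lebesgue measure -/

theorem map_mul_add_volume {b : ℂ} (hb : b ≠ 0) (s : ℂ) :
    Measure.map (fun z => b * z + s) (volume : Measure ℂ) =
      ENNReal.ofReal (‖b‖ ^ 2)⁻¹ • volume := by
  have hdet : LinearMap.det (LinearMap.mulLeft ℝ b) = ‖b‖ ^ 2 := by
    rw [← Complex.normSq_eq_norm_sq, ← Algebra.norm_complex_apply]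
    rfl
  have h0 : LinearMap.det (LinearMap.mulLeft ℝ b) ≠ 0 := by
    rw [hdet]
    exact pow_ne_zero _ (norm_ne_zero_iff.2 hb)
  have h := Measure.map_linearMap_addHaar_eq_smul_addHaar (volume : Measure ℂ) h0
  rw [hdet, abs_of_nonneg (by positivity)] at h
  have hc : (fun z => b * z + s) = (fun z => z + s) ∘ LinearMap.mulLeft ℝ b := rfl
  rw [hc, ← Measure.map_map (by fun_prop) (by fun_prop), h, Measure.map_smul,
    (measurePreserving_add_right volume s).map_eq]

theorem measurableEmbedding_mul_add {b : ℂ} (hb : b ≠ 0) (s : ℂ) :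
    MeasurableEmbedding fun z : ℂ => b * z + s :=
  ((Homeomorph.mulLeft₀ b hb).trans (Homeomorph.addRight s)).measurableEmbedding

theorem integral_comp_mul_add {b : ℂ} (hb : b ≠ 0) (s : ℂ) (F : ℂ → ℝ) :
    ∫ z, F (b * z + s) = (‖b‖ ^ 2)⁻¹ * ∫ z, F z := by
  rw [← (measurableEmbedding_mul_add hb s).integral_map, map_mul_add_volume hb,
    integral_smul_measure, ENNReal.toReal_ofReal (by positivity), smul_eq_mul]

theorem integrable_comp_mul_add {b : ℂ} (hb : b ≠ 0) (s : ℂ) {F : ℂ → ℝ} (hF : Integrable F) :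
    Integrable fun z => F (b * z + s) := by
  refine ((measurableEmbedding_mul_add hb s).integrable_map_iff (g := F)).1 ?_
  rw [map_mul_add_volume hb]
  exact hF.smul_measure ENNReal.ofReal_ne_top

theorem ae_comp_sub (s : ℂ) {q : ℂ → Prop} (hq : ∀ᵐ z, q z) : ∀ᵐ z, q (z - s) :=
  (measurePreserving_sub_right volume s).quasiMeasurePreserving.ae hq

/-! ### Almost everywhere identities for the indicator function of the attractor -/

theorem integrable_indicator_one {Ω : Set ℂ} (hΩ : IsCompact Ω) :
    Integrable (Ω.indicator (1 : ℂ → ℝ)) :=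
  (integrable_indicator_iff hΩ.measurableSet).2 (integrableOn_const hΩ.measure_lt_top.ne)

/-- The inequality ≤ holds everywhere because the pieces cover Ω. Both sides have the same integral
by `norm_root_area`, so they agree a.e. -/
theorem indicator_attractor_ae_eq {β : ℂ} (hβ : β ^ 3 - 2 * β ^ 2 - 1 = 0) (hβ_im : β.im ≠ 0)
    {Ω : Set ℂ} (h : IsAttractor (ifsAB β) Ω) {χ : ℂ → ℝ} (hχ : χ = Ω.indicator 1)
    {v : ℂ} (hv : v = β ^ 2 - 2 * β) :
    ∀ᵐ z, χ z = χ (v * z) + χ (v ^ 3 * z - 1) + χ (v * z - β + 1) := by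
  have hv1 : v * β = 1 := by rw [hv]; exact inv_mul_root hβ
  have hv0 : v ≠ 0 := left_ne_zero_of_mul_eq_one hv1
  have hnv : (‖v‖ ^ 2)⁻¹ = ‖β‖ ^ 2 := by
    rw [← inv_pow, ← norm_inv, inv_eq_of_mul_eq_one_right hv1]
  have hnv3 : (‖v ^ 3‖ ^ 2)⁻¹ = ‖β ^ 3‖ ^ 2 := by
    rw [norm_pow, norm_pow, ← inv_pow, ← inv_pow, ← norm_inv, inv_eq_of_mul_eq_one_right hv1]
  have hint : Integrable χ := hχ ▸ integrable_indicator_one h.2.1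
  have i1 : Integrable fun z => χ (v * z) := by
    simpa using integrable_comp_mul_add hv0 0 hint
  have i2 : Integrable fun z => χ (v ^ 3 * z - 1) :=
    integrable_comp_mul_add (pow_ne_zero 3 hv0) (-1) hint
  have i3 : Integrable fun z => χ (v * z - β + 1) := by
    simpa [sub_add_eq_add_sub, sub_eq_add_neg, add_assoc] using
      integrable_comp_mul_add hv0 (-β + 1) hint
  have e1 : ∫ z, χ (v * z) = ‖β‖ ^ 2 * ∫ z, χ z := by
    simpa [hnv] using integral_comp_mul_add hv0 0 χ
  have e2 : ∫ z, χ (v ^ 3 * z - 1) = ‖β ^ 3‖ ^ 2 * ∫ z, χ z := by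
    rw [← hnv3]
    exact integral_comp_mul_add (pow_ne_zero 3 hv0) (-1) χ
  have e3 : ∫ z, χ (v * z - β + 1) = ‖β‖ ^ 2 * ∫ z, χ z := by
    rw [← hnv, ← integral_comp_mul_add hv0 (-β + 1) χ]
    simp only [sub_eq_add_neg, add_assoc]
  have hle : ∀ z, χ z ≤ χ (v * z) + χ (v ^ 3 * z - 1) + χ (v * z - β + 1) := by
    intro z
    have h0 : ∀ z, 0 ≤ χ z := fun z => by
      rw [hχ]
      exact indicator_nonneg (fun _ _ => zero_le_one) z
    have h1 : ∀ z ∈ Ω, χ z = 1 := fun z hz => by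
      rw [hχ]
      exact indicator_of_mem hz _
    by_cases hz : z ∈ Ω
    · rw [h1 z hz]
      have p1 := h0 (v * z)
      have p2 := h0 (v ^ 3 * z - 1)
      have p3 := h0 (v * z - β + 1)
      have hv3 : v ^ 3 * β ^ 3 = 1 := by rw [← mul_pow, hv1, one_pow]
      rcases (mem_isAttractor_ifsAB h).1 hz with ⟨w, hw, e⟩ | ⟨w, hw, e⟩ | ⟨w, hw, e⟩
      · have : v * z = w := by linear_combination -v * e + w * hv1
        have h2 := h1 w hw
        rw [← this] at h2
        linarith
      · have : v ^ 3 * z - 1 = w := by linear_combination -v ^ 3 * e + (w + 1) * hv3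
        have h2 := h1 w hw
        rw [← this] at h2
        linarith
      · have : v * z - β + 1 = w := by linear_combination -v * e + (w + β - 1) * hv1
        have h2 := h1 w hw
        rw [← this] at h2
        linarith
    · have : χ z = 0 := by rw [hχ]; exact indicator_of_notMem hz _
      rw [this]
      have p1 := h0 (v * z)
      have p2 := h0 (v ^ 3 * z - 1)
      have p3 := h0 (v * z - β + 1)
      linarith
  have i12 : Integrable fun z => χ (v * z) + χ (v ^ 3 * z - 1) := i1.add i2
  have i123 : Integrable fun z => χ (v * z) + χ (v ^ 3 * z - 1) + χ (v * z - β + 1) := i12.add i3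
  have hzero : ∫ z, (χ (v * z) + χ (v ^ 3 * z - 1) + χ (v * z - β + 1) - χ z) = 0 := by
    rw [integral_sub i123 hint, integral_add i12 i3, integral_add i1 i2, e1, e2, e3]
    linear_combination (∫ z, χ z) * norm_root_area hβ hβ_im
  have := (integral_eq_zero_iff_of_nonneg (fun z => sub_nonneg.2 (hle z)) (i123.sub hint)).1 hzero
  filter_upwards [this] with z hz
  simp only [Pi.zero_apply] at hz
  linarith

/-- Let H be the difference of the two sides. Expanding χ(z) and χ(z - β) by
`indicator_attractor_ae_eq` gives H(z) = H(vz) a.e., hence ∫|H| = |β|² ∫|H| and H = 0 a.e. -/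
theorem indicator_attractor_sub_ae_eq {β : ℂ} (hβ : β ^ 3 - 2 * β ^ 2 - 1 = 0)
    (hβ_im : β.im ≠ 0) {Ω : Set ℂ} (h : IsAttractor (ifsAB β) Ω) {χ : ℂ → ℝ}
    (hχ : χ = Ω.indicator 1) {v : ℂ} (hv : v = β ^ 2 - 2 * β) :
    ∀ᵐ z, χ z + χ (v * z - 1) + χ (v ^ 2 * z - 1) =
      χ (z - β) + χ (v * z - β + 1) + χ (v ^ 2 * z - β + 1) := by
  have hv1 : v * β = 1 := by rw [hv]; exact inv_mul_root hβ
  have hv2 : v ^ 2 = β - 2 := by rw [hv]; linear_combination (β - 2) * hβ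
  have hv0 : v ≠ 0 := left_ne_zero_of_mul_eq_one hv1
  have hnv : (‖v‖ ^ 2)⁻¹ = ‖β‖ ^ 2 := by
    rw [← inv_pow, ← norm_inv, inv_eq_of_mul_eq_one_right hv1]
  have hint : Integrable χ := hχ ▸ integrable_indicator_one h.2.1
  have J := indicator_attractor_ae_eq hβ hβ_im h hχ hv
  have J' : ∀ᵐ z, χ (z - β) = χ (v * z - 1) + χ (v ^ 3 * z - β + 1) + χ (v * z - β) := by
    have := ae_comp_sub β J
    filter_upwards [this] with z hz
    convert! hz using 2
    · congr 2
      · linear_combination hv1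
      · linear_combination v ^ 2 * hv1 + hv2
    · congr 1; linear_combination hv1
  let H : ℂ → ℝ := fun z => χ z + χ (v * z - 1) + χ (v ^ 2 * z - 1) -
      (χ (z - β) + χ (v * z - β + 1) + χ (v ^ 2 * z - β + 1))
  have hH : ∀ᵐ z, H z = H (v * z) := by
    filter_upwards [J, J'] with z hz hz'
    simp only [H]
    have a1 : v * (v * z) = v ^ 2 * z := by ring
    have a2 : v ^ 2 * (v * z) = v ^ 3 * z := by ring
    rw [a1, a2]
    linear_combination hz - hz'
  have hHint : Integrable H := by
    have c : ∀ b : ℂ, b ≠ 0 → Integrable fun z => χ (b * z - β + 1) := fun b hb => by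
      simpa [sub_add_eq_add_sub, sub_eq_add_neg, add_assoc] using
        integrable_comp_mul_add hb (-β + 1) hint
    refine ((hint.add ?_).add ?_).sub ((Integrable.add ?_ ?_).add ?_)
    · exact integrable_comp_mul_add hv0 (-1) hint
    · exact integrable_comp_mul_add (pow_ne_zero 2 hv0) (-1) hint
    · simpa [sub_eq_add_neg] using integrable_comp_mul_add one_ne_zero (-β) hint
    · exact c v hv0
    · exact c (v ^ 2) (pow_ne_zero 2 hv0)
  have hn : ∫ z, |H z| = ‖β‖ ^ 2 * ∫ z, |H z| := by
    have := integral_comp_mul_add hv0 0 fun z => |H z|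
    rw [hnv] at this
    rw [← this]
    refine integral_congr_ae ?_
    filter_upwards [hH] with z hz
    simp [hz]
  have hz : ∫ z, |H z| = 0 := by
    have h1 : ‖β‖ ^ 2 ≠ 1 :=
      (pow_lt_one₀ (norm_nonneg _) (norm_root_lt_one hβ hβ_im) two_ne_zero).ne
    have : (1 - ‖β‖ ^ 2) * ∫ z, |H z| = 0 := by linear_combination hn
    exact (mul_eq_zero.1 this).resolve_left (sub_ne_zero.2 h1.symm)
  have := (integral_eq_zero_iff_of_nonneg (fun z => abs_nonneg (H z)) hHint.abs).1 hz
  filter_upwards [this] with z hz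
  exact sub_eq_zero.1 (abs_eq_zero.1 hz)

/-! ### The multiplicity of the covering by lattice translates -/

/-- The number of lattice translates of `Ω` that contain `z`, as a real number. -/
noncomputable def coveringMultiplicity (v : ℂ) (Ω : Set ℂ) (z : ℂ) : ℝ :=
  ∑' p, Ω.indicator 1 (z - latticePoint v p)

theorem summable_indicator_latticePoint {v : ℂ} (hv : v.im ≠ 0) {Ω : Set ℂ} (hΩ : IsCompact Ω)
    {b : ℂ} (hb : b ≠ 0) (s z : ℂ) :
    Summable fun p => Ω.indicator (1 : ℂ → ℝ) (b * (z - latticePoint v p) + s) := by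
  refine summable_of_hasFiniteSupport ((finite_latticePoint_mem hv
    (hΩ.image (f := fun w => z - b⁻¹ * (w - s)) (by fun_prop)).isBounded).subset ?_)
  intro p hp
  refine ⟨_, mem_of_indicator_ne_zero hp, ?_⟩
  field_simp
  ring

theorem summable_coveringMultiplicity {v : ℂ} (hv : v.im ≠ 0) {Ω : Set ℂ} (hΩ : IsCompact Ω)
    (z : ℂ) : Summable fun p => Ω.indicator (1 : ℂ → ℝ) (z - latticePoint v p) := by
  simpa using summable_indicator_latticePoint hv hΩ one_ne_zero 0 z

theorem coveringMultiplicity_sub_latticePoint (v : ℂ) (Ω : Set ℂ) (z : ℂ) (q : ℤ × ℤ) :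
    coveringMultiplicity v Ω (z - latticePoint v q) = coveringMultiplicity v Ω z := by
  unfold coveringMultiplicity
  rw [← (Equiv.addLeft q).tsum_eq fun p => Ω.indicator (1 : ℂ → ℝ) (z - latticePoint v p)]
  simp only [Equiv.coe_addLeft, latticePoint_add, sub_sub]

theorem two_le_coveringMultiplicity {v : ℂ} (hv : v.im ≠ 0) {Ω : Set ℂ} (hΩ : IsCompact Ω)
    {z : ℂ} {p q : ℤ × ℤ} (hpq : p ≠ q) (hp : z ∈ tile v Ω p) (hq : z ∈ tile v Ω q) :
    2 ≤ coveringMultiplicity v Ω z := by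
  have h := (summable_coveringMultiplicity hv hΩ z).sum_le_tsum {p, q}
    fun _ _ => indicator_nonneg (fun _ _ => zero_le_one) _
  rw [Finset.sum_pair hpq, indicator_of_mem (mem_tile.1 hp), indicator_of_mem (mem_tile.1 hq)] at h
  simp only [one_add_one_eq_two] at h
  exact h

theorem coveringMultiplicity_le_one {v : ℂ} {Ω : Set ℂ} {z : ℂ}
    (h : ∀ p ≠ 0, z ∉ tile v Ω p) : coveringMultiplicity v Ω z ≤ 1 := by
  unfold coveringMultiplicity
  rw [tsum_eq_single 0 fun p hp => indicator_of_notMem (mem_tile.not.1 (h p hp)) _]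
  exact indicator_le_self' (fun _ _ => zero_le_one) _

/-- When `indicator_attractor_sub_ae_eq` is summed over L, the last two terms of each side cancel
after reindexing, leaving the two multiplicities. -/
theorem coveringMultiplicity_ae_eq_sub_root {β : ℂ} (hβ : β ^ 3 - 2 * β ^ 2 - 1 = 0)
    (hβ_im : β.im ≠ 0) {Ω : Set ℂ} (h : IsAttractor (ifsAB β) Ω) :
    ∀ᵐ z, coveringMultiplicity (β ^ 2 - 2 * β) Ω z =
      coveringMultiplicity (β ^ 2 - 2 * β) Ω (z - β) := by
  have hvi := inv_root_im_ne_zero hβ hβ_im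
  obtain ⟨v, hv⟩ : ∃ v, v = β ^ 2 - 2 * β := ⟨_, rfl⟩
  obtain ⟨χ, hχ⟩ : ∃ χ : ℂ → ℝ, χ = Ω.indicator 1 := ⟨_, rfl⟩
  have hv1 : v * β = 1 := by rw [hv]; exact inv_mul_root hβ
  have hv0 : v ≠ 0 := left_ne_zero_of_mul_eq_one hv1
  have hv2 : v ^ 2 = β - 2 := by rw [hv]; linear_combination (β - 2) * hβ
  have J : ∀ᵐ z, ∀ p, _ := ae_all_iff.2 fun p => ae_comp_sub (latticePoint v p)
    (indicator_attractor_sub_ae_eq hβ hβ_im h hχ hv)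
  rw [← hv] at hvi ⊢
  unfold coveringMultiplicity
  rw [← hχ]
  filter_upwards [J] with z hz
  have S : ∀ (b s : ℂ), b ≠ 0 → Summable fun p => χ (b * (z - latticePoint v p) + s) :=
    fun b s hb => hχ ▸ summable_indicator_latticePoint hvi h.2.1 hb s z
  have S1 : Summable fun p => χ (z - latticePoint v p) := by simpa using S 1 0 one_ne_zero
  have S2 : Summable fun p => χ (v * (z - latticePoint v p) - 1) := S v (-1) hv0
  have S3 : Summable fun p => χ (v ^ 2 * (z - latticePoint v p) - 1) :=
    S (v ^ 2) (-1) (pow_ne_zero 2 hv0)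
  have T1 : Summable fun p => χ (z - latticePoint v p - β) := by
    simpa [sub_eq_add_neg] using S 1 (-β) one_ne_zero
  -- Since β - 2 = v², the change of constant from -1 to 1 - β is a translation of z by v here, and
  -- by 1 in `e3`.
  have e2 : ∀ p, v * (z - latticePoint v p) - β + 1 =
      v * (z - latticePoint v (p + (0, 1))) - 1 := fun p => by
    simp [latticePoint]
    linear_combination hv2
  have e3 : ∀ p, v ^ 2 * (z - latticePoint v p) - β + 1 =
      v ^ 2 * (z - latticePoint v (p + (1, 0))) - 1 := fun p => by
    simp [latticePoint]
    linear_combination hv2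
  have T2 : Summable fun p => χ (v * (z - latticePoint v p) - β + 1) := by
    simp only [e2]
    exact (Equiv.addRight ((0, 1) : ℤ × ℤ)).summable_iff.2 S2
  have T3 : Summable fun p => χ (v ^ 2 * (z - latticePoint v p) - β + 1) := by
    simp only [e3]
    exact (Equiv.addRight ((1, 0) : ℤ × ℤ)).summable_iff.2 S3
  have r2 : ∑' p, χ (v * (z - latticePoint v p) - β + 1) =
      ∑' p, χ (v * (z - latticePoint v p) - 1) := by
    simp only [e2]
    exact (Equiv.addRight ((0, 1) : ℤ × ℤ)).tsum_eq
      fun p => χ (v * (z - latticePoint v p) - 1)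
  have r3 : ∑' p, χ (v ^ 2 * (z - latticePoint v p) - β + 1) =
      ∑' p, χ (v ^ 2 * (z - latticePoint v p) - 1) := by
    simp only [e3]
    exact (Equiv.addRight ((1, 0) : ℤ × ℤ)).tsum_eq
      fun p => χ (v ^ 2 * (z - latticePoint v p) - 1)
  have key := tsum_congr (L := .unconditional _) hz
  rw [(S1.add S2).tsum_add S3, S1.tsum_add S2, (T1.add T2).tsum_add T3, T1.tsum_add T2, r2, r3]
    at key
  simp only [sub_right_comm z β]
  linarith

theorem coveringMultiplicity_ae_eq_sub {β : ℂ} (hβ : β ^ 3 - 2 * β ^ 2 - 1 = 0)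
    (hβ_im : β.im ≠ 0) {Ω : Set ℂ} (h : IsAttractor (ifsAB β) Ω) (k : ℤ) (q : ℤ × ℤ) :
    ∀ᵐ z, coveringMultiplicity (β ^ 2 - 2 * β) Ω z =
      coveringMultiplicity (β ^ 2 - 2 * β) Ω (z - (k * β + latticePoint (β ^ 2 - 2 * β) q)) := by
  simp only [← sub_sub, coveringMultiplicity_sub_latticePoint]
  have hβM := coveringMultiplicity_ae_eq_sub_root hβ hβ_im h
  have hnat : ∀ n : ℕ, ∀ᵐ z, coveringMultiplicity (β ^ 2 - 2 * β) Ω z =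
      coveringMultiplicity (β ^ 2 - 2 * β) Ω (z - n * β) := fun n => by
    induction n with
    | zero => simp
    | succ n ih =>
      filter_upwards [ih, ae_comp_sub (n * β) hβM] with z h1 h2
      rw [h1, h2]
      congr 1
      push_cast
      ring
  obtain ⟨n, rfl | rfl⟩ := k.eq_nat_or_neg
  · exact_mod_cast hnat n
  · filter_upwards [ae_comp_sub (-(n * β)) (hnat n)] with z hz
    rw [show z - -(n * β) - n * β = z by ring] at hz
    rw [← hz]
    congr 1
    push_cast
    ring

/-! ### Overlaps of translates -/

/-- The set of points that lie in at least two translates. -/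
def overlap (v : ℂ) (Ω : Set ℂ) : Set ℂ :=
  {z | ∃ p q, p ≠ q ∧ z ∈ tile v Ω p ∧ z ∈ tile v Ω q}

theorem isOpen_compl_iUnion_tile_ne_zero {v : ℂ} (hv : v.im ≠ 0) {Ω : Set ℂ} (hΩ : IsCompact Ω) :
    IsOpen {z | ∀ p ≠ 0, z ∉ tile v Ω p} := by
  have hcl : IsClosed (⋃ p : {p : ℤ × ℤ // p ≠ 0}, tile v Ω p) :=
    ((locallyFinite_tile hv hΩ.isBounded).comp_injective Subtype.val_injective).isClosed_iUnion
      fun p => (isCompact_tile hΩ p.1).isClosed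
  convert! hcl.isOpen_compl using 1
  ext z
  simp

/-- Off a null set, all countably many translations by ℤ[β] preserve the multiplicity. One of them
moves an overlap point, of multiplicity at least 2, close to -β/2, where it is at most 1. -/
theorem volume_overlap {β : ℂ} (hβ : β ^ 3 - 2 * β ^ 2 - 1 = 0) (hβ_im : β.im ≠ 0)
    {Ω : Set ℂ} (h : IsAttractor (ifsAB β) Ω) : volume (overlap (β ^ 2 - 2 * β) Ω) = 0 := by
  have hv := inv_root_im_ne_zero hβ hβ_im
  have hU := isOpen_compl_iUnion_tile_ne_zero hv h.2.1
  obtain ⟨ε, hε, hball⟩ := Metric.isOpen_iff.1 hU _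
    fun p hp => neg_half_root_notMem_tile hβ hβ_im h hp
  have hae : ∀ᵐ z, ∀ kq : ℤ × ℤ × ℤ, _ :=
    ae_all_iff.2 fun kq => coveringMultiplicity_ae_eq_sub hβ hβ_im h kq.1 kq.2
  refine measure_mono_null ?_ (ae_iff.1 hae)
  rintro z ⟨p, q, hpq, hp, hq⟩ hz
  obtain ⟨k, r, hkr⟩ := exists_norm_sub_root_ring_lt hβ hβ_im (z + β / 2) hε
  have h2 := two_le_coveringMultiplicity hv h.2.1 hpq hp hq
  rw [hz (k, r)] at h2
  have hmem : z - (k * β + latticePoint (β ^ 2 - 2 * β) r) ∈ Metric.ball (-(β / 2)) ε := by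
    rw [Metric.mem_ball, dist_eq_norm]
    convert! hkr using 2
    ring
  have h1 := coveringMultiplicity_le_one (hball hmem)
  linarith

theorem mem_of_forall_notMem_tile {β : ℂ} (hβ : β ^ 3 - 2 * β ^ 2 - 1 = 0) (hβ_im : β.im ≠ 0)
    {Ω : Set ℂ} (h : IsAttractor (ifsAB β) Ω) {w : ℂ}
    (hw : ∀ p ≠ 0, w ∉ tile (β ^ 2 - 2 * β) Ω p) : w ∈ Ω := by
  obtain ⟨p, hp⟩ := mem_iUnion.1 (iUnion_tile_eq_univ hβ hβ_im h ▸ mem_univ w)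
  by_cases hp0 : p = 0
  · rwa [hp0, tile_zero] at hp
  · exact absurd hp (hw p hp0)

/-- A point of Ω in no other translate has a neighbourhood missing all of them by local finiteness;
the covering forces that neighbourhood into Ω. -/
theorem frontier_subset_overlap {β : ℂ} (hβ : β ^ 3 - 2 * β ^ 2 - 1 = 0) (hβ_im : β.im ≠ 0)
    {Ω : Set ℂ} (h : IsAttractor (ifsAB β) Ω) : frontier Ω ⊆ overlap (β ^ 2 - 2 * β) Ω := by
  intro z hz
  have hzΩ : z ∈ Ω := h.2.1.isClosed.frontier_subset hz
  by_contra hno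
  have hU := isOpen_compl_iUnion_tile_ne_zero (inv_root_im_ne_zero hβ hβ_im) h.2.1
  have hzU : ∀ p ≠ 0, z ∉ tile (β ^ 2 - 2 * β) Ω p := fun p hp hzp =>
    hno ⟨p, 0, hp, hzp, by rwa [tile_zero]⟩
  refine hz.2 (mem_interior.2 ⟨_, fun w hw => mem_of_forall_notMem_tile hβ hβ_im h hw, hU, hzU⟩)

theorem interior_attractor_nonempty {β : ℂ} (hβ : β ^ 3 - 2 * β ^ 2 - 1 = 0) (hβ_im : β.im ≠ 0)
    {Ω : Set ℂ} (h : IsAttractor (ifsAB β) Ω) : (interior Ω).Nonempty := by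
  have hU := isOpen_compl_iUnion_tile_ne_zero (inv_root_im_ne_zero hβ hβ_im) h.2.1
  refine ⟨_, mem_interior.2 ⟨_, fun w hw => mem_of_forall_notMem_tile hβ hβ_im h hw, hU,
    fun p hp => neg_half_root_notMem_tile hβ hβ_im h hp⟩⟩

/-! ### The tiling -/

theorem isPeriod_latticeTranslates (u v : ℂ) (Ω : Set ℂ) (a b : ℤ) :
    IsPeriod (a * u + b * v) (latticeTranslates u v Ω) := by
  ext t
  constructor
  · rintro ⟨_, ⟨m, n, rfl⟩, rfl⟩
    refine ⟨a + m, b + n, ?_⟩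
    simp only [image_image]
    congr 1
    funext z
    push_cast
    ring
  · rintro ⟨m, n, rfl⟩
    refine ⟨_, ⟨m - a, n - b, rfl⟩, ?_⟩
    simp only [image_image]
    congr 1
    funext z
    push_cast
    ring

theorem latticeTranslates_one_eq_range (v : ℂ) (Ω : Set ℂ) :
    latticeTranslates 1 v Ω = range (tile v Ω) := by
  ext t
  constructor
  · rintro ⟨m, n, rfl⟩
    exact ⟨(m, n), rfl⟩
  · rintro ⟨p, rfl⟩
    exact ⟨p.1, p.2, rfl⟩

theorem isTiling_latticeTranslates {β : ℂ} (hβ : β ^ 3 - 2 * β ^ 2 - 1 = 0) (hβ_im : β.im ≠ 0)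
    {Ω : Set ℂ} (h : IsAttractor (ifsAB β) Ω) :
    IsTiling (latticeTranslates 1 (β ^ 2 - 2 * β) Ω) := by
  rw [latticeTranslates_one_eq_range]
  refine ⟨countable_range _, ?_, ?_, ?_, ?_⟩
  · rintro _ ⟨p, rfl⟩
    exact isCompact_tile h.2.1 p
  · rintro _ ⟨p, rfl⟩
    have e : tile (β ^ 2 - 2 * β) Ω p =
        Homeomorph.addLeft (latticePoint (β ^ 2 - 2 * β) p) '' Ω := rfl
    rw [e, ← Homeomorph.image_interior]
    exact (interior_attractor_nonempty hβ hβ_im h).image _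
  · rw [sUnion_range, iUnion_tile_eq_univ hβ hβ_im h]
  · rintro _ ⟨p, rfl⟩ _ ⟨q, rfl⟩ hpq
    -- An open set of measure zero is empty.
    rw [disjoint_iff_inter_eq_empty]
    refine (isOpen_interior.inter isOpen_interior).measure_eq_zero_iff volume |>.1
      (measure_mono_null ?_ (volume_overlap hβ hβ_im h))
    exact fun z hz => ⟨p, q, fun e => hpq (by rw [e]), interior_subset hz.1, interior_subset hz.2⟩

theorem isPrototile_latticeTranslates (u v : ℂ) (Ω : Set ℂ) :
    IsPrototile Ω (latticeTranslates u v Ω) := by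
  rintro _ ⟨m, n, rfl⟩
  exact ⟨IsometryEquiv.addLeft (m * u + n * v), rfl⟩

theorem isPeriodic_latticeTranslates {v : ℂ} (hv : v.im ≠ 0) (Ω : Set ℂ) :
    IsPeriodic (latticeTranslates 1 v Ω) := by
  refine ⟨1, v, ?_, ?_, ?_⟩
  · rw [LinearIndependent.pair_iff]
    intro s t hst
    have ht : t = 0 := by simpa [hv] using congrArg Complex.im hst
    subst ht
    exact ⟨by simpa using congrArg Complex.re hst, rfl⟩
  · simpa using isPeriod_latticeTranslates 1 v Ω 1 0
  · simpa using isPeriod_latticeTranslates 1 v Ω 0 1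

theorem mainTheorem7 (β : ℂ) (hβ : β ^ 3 - 2 * β ^ 2 - 1 = 0) (hβ_im : β.im ≠ 0) :
    (∃! Ω : Set ℂ, IsAttractor (ifsAB β) Ω) ∧
    ∀ Ω : Set ℂ, IsAttractor (ifsAB β) Ω →
      Equiv.pointReflection (-(1 / 2) * β) '' Ω = Ω ∧
      dimH Ω = 2 ∧
      (0 < μH[2] Ω ∧ 0 < volume Ω) ∧
      volume (frontier Ω) = 0 ∧
      (IsTiling (latticeTranslates 1 (β ^ 2 - 2 * β) Ω) ∧
        IsPrototile Ω (latticeTranslates 1 (β ^ 2 - 2 * β) Ω) ∧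
        IsPeriodic (latticeTranslates 1 (β ^ 2 - 2 * β) Ω)) := by
  have h1 := norm_root_lt_one hβ hβ_im
  refine ⟨existsUnique_isAttractor_ifsAB h1, fun Ω h => ⟨?_, ?_, ⟨?_, ?_⟩,
    measure_mono_null (frontier_subset_overlap hβ hβ_im h) (volume_overlap hβ hβ_im h),
    isTiling_latticeTranslates hβ hβ_im h, isPrototile_latticeTranslates _ _ _,
    isPeriodic_latticeTranslates (inv_root_im_ne_zero hβ hβ_im) Ω⟩⟩
  · have hσ : ∀ z, Equiv.pointReflection (-(1 / 2) * β) z = -z - β := fun z => by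
      rw [Equiv.pointReflection_apply, vsub_eq_sub, vadd_eq_add]
      ring
    refine Subset.antisymm ?_ fun z hz => ⟨-z - β, ?_, by rw [hσ]; ring⟩
    · rintro _ ⟨z, hz, rfl⟩
      rw [hσ]
      exact neg_sub_mem_isAttractor_ifsAB hβ h1 h hz
    · exact neg_sub_mem_isAttractor_ifsAB hβ h1 h hz
  · rw [Real.dimH_of_nonempty_interior (interior_attractor_nonempty hβ hβ_im h),
      Complex.finrank_real_complex]
    norm_num
  · have hμ : (μH[2] : Measure ℂ).IsAddHaarMeasure := by
      have := isAddHaarMeasure_hausdorffMeasure (E := ℂ)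
      rwa [Complex.finrank_real_complex] at this
    exact Measure.measure_pos_of_nonempty_interior _ (interior_attractor_nonempty hβ hβ_im h)
  · exact Measure.measure_pos_of_nonempty_interior _ (interior_attractor_nonempty hβ hβ_im h)
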